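/- Fix an integer $d\ge 2$. For each $n\ge 1$ consider the supermarket model with $n$ parallel first-in-first-out queues: each of the $n$ servers has independent exponential service times of rate $1$, customers arrive in a Poisson stream of rate $n\lambda_n$ with $0\le\lambda_n<1$, and an arriving customer samples $d$ queues independently and uniformly at random (with replacement) and joins the shortest of them, ties being broken uniformly at random. Assume that there are reals $\eta_n\ge 1$ with $\eta_n\to\infty$ and a constant $\beta>0$ such that $\eta_n(1-\lambda_n)\to\beta$ as $n\to\infty$. Let the $n$-th system be in steady state, that is, let its vector of queue lengths (customers in service included) have a stationary distribution, and let $S_i^n(\infty)$ be the fraction of queues of length at least $i$. Then (a) for every $n\ge1$ and every integer $i\ge 0$, $$\mathbb{E}\,S_i^n(\infty)\ \ge\ 1-(1-\lambda_n)\,\frac{d^i-1}{d-1}.$$ Moreover, for every real sequence $\omega_n\to\infty$, as $n\to\infty$: (b) the fraction of queues of length at least $\log_d\eta_n-\omega_n$ tends to $1$ in probability; (c) with probability tending to $1$, a customer arriving in steady state joins a queue that already contains at least $\log_d\eta_n-\omega_n$ customers, and hence the customer's expected delay, given the number of customers in that queue, is at least $\log_d\eta_n-\omega_n$; here the delay is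 the time until the start of service, i.e. the sum of the (remaining) service times of the customers ahead, which are independent and exponential of rate $1$; (d) if in addition $\omega_n/\sqrt{\log_d\eta_n}\to\infty$, then the delay itself is at least $\log_d\eta_n-\omega_n$ with probability tending to $1$. -/

import Mathlib

open MeasureTheory ProbabilityTheory Filter Topology
open scoped NNReal ENNReal

/-! The supermarket model with `n` parallel first-in-first-out queues.  A state is the vector
`x : Fin n → ℕ` of queue lengths (customers in service included).  Customers arrive in a Poisson
stream of rate `n * lam`, each of them samples `d` queues, and the servers work at rate one. -/

namespace Supermarket

noncomputable section

/-- The sampled queues of minimal length, when the sampled queues are `c 0, …, c (d - 1)`. -/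
def shortest {n d : ℕ} (x : Fin n → ℕ) (c : Fin d → Fin n) : Finset (Fin n) :=
  (Finset.univ.image c).filter fun j => ∀ k, x j ≤ x (c k)

theorem shortest_nonempty {n d : ℕ} [NeZero d] (x : Fin n → ℕ) (c : Fin d → Fin n) :
    (shortest x c).Nonempty := by
  obtain ⟨k, hk⟩ := Finite.exists_min fun k => x (c k)
  exact ⟨c k, by simp [shortest, hk]⟩

/-- The queue joined by a customer who finds the state `x`: it is chosen uniformly among the
shortest of `d` queues that are sampled uniformly and independently (with replacement). -/
def joinedQueue (d : ℕ) [NeZero d] {n : ℕ} [NeZero n] (x : Fin n → ℕ) : PMF (Fin n) :=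
  (PMF.uniformOfFintype (Fin d → Fin n)).bind fun c =>
    PMF.uniformOfFinset (shortest x c) (shortest_nonempty x c)

/-- The state after the arrival of a customer in state `x`. -/
def arrival (d : ℕ) [NeZero d] {n : ℕ} [NeZero n] (x : Fin n → ℕ) : PMF (Fin n → ℕ) :=
  (joinedQueue d x).map fun j => Function.update x j (x j + 1)

/-- The state after the service clock of a uniformly chosen server has rung in state `x`: that
server's queue loses one customer, unless it is empty. -/
def service {n : ℕ} [NeZero n] (x : Fin n → ℕ) : PMF (Fin n → ℕ) :=
  (PMF.uniformOfFintype (Fin n)).map fun j => Function.update x j (x j - 1)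

/-- Whether an event of the superposed Poisson clocks (arrivals at total rate `n * lam`, services
at total rate `n`) is an arrival (`true`) or a service (`false`). -/
def eventType (lam : ℝ≥0) : PMF Bool :=
  PMF.ofFintype (fun b => ((cond b (lam / (1 + lam)) (1 / (1 + lam)) : ℝ≥0) : ℝ≥0∞)) (by
    have h : (1 + lam : ℝ≥0) ≠ 0 := by positivity
    have : lam / (1 + lam) + 1 / (1 + lam) = (1 : ℝ≥0) := by field_simp; ring
    rw [Fintype.sum_bool]
    exact_mod_cast this)

/-- The state after the next event of the superposed Poisson clocks. -/
def step (d : ℕ) [NeZero d] {n : ℕ} [NeZero n] (lam : ℝ≥0) (x : Fin n → ℕ) : PMF (Fin n → ℕ) :=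
  (eventType lam).bind fun b => cond b (arrival d x) (service x)

/-- The law of the state after `k` events, started from the law `μ`. -/
def afterEvents (d : ℕ) [NeZero d] {n : ℕ} [NeZero n] (lam : ℝ≥0) (k : ℕ)
    (μ : PMF (Fin n → ℕ)) : PMF (Fin n → ℕ) :=
  (fun ν => ν.bind (step d lam))^[k] μ

/-- The law of the state at time `t`, started from the law `μ`: the number of events up to time
`t` is Poisson with mean `n * (1 + lam) * t`. -/
def lawAt (d : ℕ) [NeZero d] {n : ℕ} [NeZero n] (lam : ℝ≥0) (t : ℝ≥0)
    (μ : PMF (Fin n → ℕ)) : PMF (Fin n → ℕ) :=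
  (poissonMeasure ((n : ℝ≥0) * (1 + lam) * t)).toPMF.bind fun k => afterEvents d lam k μ

/-- `μ` is a steady-state law of the supermarket model: it does not change over time. -/
def IsSteadyState (d : ℕ) [NeZero d] {n : ℕ} [NeZero n] (lam : ℝ≥0)
    (μ : PMF (Fin n → ℕ)) : Prop :=
  ∀ t : ℝ≥0, lawAt d lam t μ = μ

/-- The fraction of queues of length at least `r`, in state `x`. -/
def fracAtLeast {n : ℕ} (x : Fin n → ℕ) (r : ℝ) : ℝ :=
  ((Finset.univ.filter fun j => r ≤ (x j : ℝ)).card : ℝ) / n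

/-- The law of the number of customers found (the one in service included) in the queue that an
arriving customer joins, when the state found on arrival has law `μ`. -/
def joinedLength (d : ℕ) [NeZero d] {n : ℕ} [NeZero n] (μ : PMF (Fin n → ℕ)) : PMF ℕ :=
  μ.bind fun x => (joinedQueue d x).map x

/-- The law of the delay (the time until the start of service) of a customer with `m` customers
ahead in a first-in-first-out queue: the sum of `m` independent (remaining) service times, each
of them exponential with rate one. -/
def delayGiven (m : ℕ) : Measure ℝ :=
  (Measure.pi fun _ : Fin m => expMeasure 1).map fun v => ∑ k, v k

/-- The law of the delay of an arriving customer, when the state found on arrival has law `μ`. -/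
def delayLaw (d : ℕ) [NeZero d] {n : ℕ} [NeZero n] (μ : PMF (Fin n → ℕ)) : Measure ℝ :=
  (joinedLength d μ).toMeasure.bind delayGiven

end

end Supermarket

namespace Supermarket

noncomputable section

/-! Write `S_m` for the fraction of queues of length at least `m`. A steady-state law is invariant
under one step of the uniformized jump chain (`IsSteadyState.bind_step`). Balancing up- and
down-crossings of each level by `excess m`, then summing over levels, gives `E S_{m+1} = lam * E S_m
^ d` (`IsSteadyState.integral_fracAtLeast_succ`).

Bernoulli's inequality bounds `E S_m ^ d` below by `1 - d * (1 - E S_m)`, so the deficits `u_m = 1 -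
E S_m` satisfy `u_{m+1} ≤ (1 - lam) + d * u_m` with `u_0 = 0`; this is the geometric sum in (a).

At height `log_d η - ω` the deficit is at most a constant times `η * (1 - lam) * d ^ (-ω)`, which
tends to zero. Markov's inequality yields (b). An arrival joins a queue of length at least `m` with
probability `E S_m ^ d`, which yields (c). For (d), half of `ω` is spent on the joined queue length
and half on Chebyshev's inequality for the service times. -/

/-! ### From continuous time to the jump chain. -/

/-- Subtracting `a 0` termwise leaves a series with sum zero. Its linear term `s * (a 1 - a 0)` is
balanced by a tail of size at most `exp s - 1 - s ≤ s ^ 2`; divide by `s` and let `s` tend to zero.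
-/
theorem coeff_one_eq_coeff_zero_of_hasSum {a : ℕ → ℝ} (ha : ∀ k, |a k - a 0| ≤ 1)
    (h : ∀ s : ℝ, 0 < s → HasSum (fun k => s ^ k / k.factorial * a k) (Real.exp s * a 0)) :
    a 1 = a 0 := by
  have key : ∀ s : ℝ, 0 < s → s ≤ 1 → |a 1 - a 0| ≤ s := by
    intro s hs hs1
    have hexp : HasSum (fun k : ℕ => s ^ k / k.factorial) (Real.exp s) := by
      rw [Real.exp_eq_exp_ℝ]; exact NormedSpace.expSeries_div_hasSum_exp s
    have hb := (h s hs).sub (hexp.mul_right (a 0))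
    have hb2 := (hasSum_nat_add_iff' 2).2 hb
    have hexp2 := (hasSum_nat_add_iff' 2).2 hexp
    have hle := hb2.norm_le_of_bounded hexp2 (fun k => by
      rw [← mul_sub, norm_mul, Real.norm_of_nonneg (by positivity), Real.norm_eq_abs]
      exact mul_le_of_le_one_right (by positivity) (ha _))
    simp [Finset.sum_range_succ] at hle
    have h1 := Real.abs_exp_sub_one_sub_id_le (x := s) (by rwa [abs_of_pos hs])
    have h2 : |s * a 1 - s * a 0| ≤ s ^ 2 := by
      rw [abs_sub_comm]
      refine hle.trans ((le_abs_self _).trans ?_)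
      rw [← sub_sub]; exact h1
    rw [← mul_sub, abs_mul, abs_of_pos hs, sq] at h2
    exact le_of_mul_le_mul_left h2 hs
  by_contra hne
  have hpos : 0 < |a 1 - a 0| := abs_pos.2 (sub_ne_zero.2 hne)
  have := key (|a 1 - a 0| / 2) (by positivity) (by linarith [ha 1])
  linarith

theorem IsSteadyState.bind_step {d : ℕ} [NeZero d] {n : ℕ} [NeZero n] {lam : ℝ≥0}
    {μ : PMF (Fin n → ℕ)} (hμ : IsSteadyState d lam μ) : μ.bind (step d lam) = μ := by
  ext x
  have hle : ∀ k, (afterEvents d lam k μ x).toReal ≤ 1 := fun k =>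
    ENNReal.toReal_le_of_le_ofReal zero_le_one (by simpa using PMF.coe_le_one _ _)
  have hnn : ∀ k, 0 ≤ (afterEvents d lam k μ x).toReal := fun k => ENNReal.toReal_nonneg
  have hc : (0 : ℝ≥0) < (n : ℝ≥0) * (1 + lam) := by
    have := NeZero.pos n
    positivity
  have key := coeff_one_eq_coeff_zero_of_hasSum (a := fun k => (afterEvents d lam k μ x).toReal)
    (fun k => abs_le.2 ⟨by linarith [hle 0, hnn k], by linarith [hle k, hnn 0]⟩)
    (by
      intro s hs
      set r : ℝ≥0 := ⟨s, hs.le⟩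
      -- This time makes the Poisson mean equal to `s`; multiplying by `exp s` then clears the
      -- Poisson normalization.
      have h := congrArg (fun p : PMF (Fin n → ℕ) => p x) (hμ (r / ((n : ℝ≥0) * (1 + lam))))
      simp only [lawAt, mul_div_cancel₀ _ hc.ne', PMF.bind_apply, Measure.toPMF_apply] at h
      have hsum : Summable fun k =>
          (poissonMeasure r {k} * afterEvents d lam k μ x).toReal := by
        refine ENNReal.summable_toReal ?_
        rw [h]
        exact PMF.apply_ne_top _ _
      have h2 := hsum.hasSum
      rw [← ENNReal.tsum_toReal_eq (fun k => ENNReal.mul_ne_top (measure_ne_top _ _)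
        (PMF.apply_ne_top _ _)), h] at h2
      have h3 := h2.mul_left (Real.exp s)
      convert! h3 using 2 with k
      rw [ENNReal.toReal_mul, ← measureReal_def, poissonMeasure_real_singleton]
      change _ = Real.exp s * (Real.exp (-s) * s ^ k / k.factorial * _)
      rw [← mul_assoc, mul_div_assoc, ← mul_assoc, ← Real.exp_add, add_neg_cancel, Real.exp_zero,
        one_mul])
  exact (ENNReal.toReal_eq_toReal_iff' (PMF.apply_ne_top _ _) (PMF.apply_ne_top _ _)).1 key

/-! ### Fractions of long queues and the joined queue. -/

theorem toMeasure_bind_eq_lintegral {α β : Type*} [MeasurableSpace α] [Countable α]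
    [MeasurableSingletonClass α] [MeasurableSpace β] (p : PMF α) (f : α → PMF β) {s : Set β}
    (hs : MeasurableSet s) :
    (p.bind f).toMeasure s = ∫⁻ x, (f x).toMeasure s ∂p.toMeasure := by
  rw [PMF.toMeasure_bind_apply _ _ _ hs, lintegral_countable']
  simp [PMF.toMeasure_apply_singleton, mul_comm]

/-- The set of queues of length at least `m`, in state `x`. -/
def longQueues {n : ℕ} (m : ℕ) (x : Fin n → ℕ) : Finset (Fin n) :=
  Finset.univ.filter fun j => m ≤ x j

theorem fracAtLeast_natCast {n : ℕ} (x : Fin n → ℕ) (m : ℕ) :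
    fracAtLeast x m = ((longQueues m x).card : ℝ) / n := by
  simp [fracAtLeast, longQueues]

theorem ofReal_fracAtLeast {n : ℕ} [NeZero n] (x : Fin n → ℕ) (m : ℕ) :
    ENNReal.ofReal (fracAtLeast x m) = ((longQueues m x).card : ℝ≥0∞) / n := by
  rw [fracAtLeast_natCast, ENNReal.ofReal_div_of_pos (by exact_mod_cast NeZero.pos n)]
  simp

theorem fracAtLeast_nonneg {n : ℕ} (x : Fin n → ℕ) (r : ℝ) : 0 ≤ fracAtLeast x r := by
  unfold fracAtLeast; positivity

theorem fracAtLeast_le_one {n : ℕ} (x : Fin n → ℕ) (r : ℝ) : fracAtLeast x r ≤ 1 := by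
  refine div_le_one_of_le₀ ?_ (by positivity)
  exact_mod_cast (Finset.card_le_univ _).trans_eq (Fintype.card_fin n)

theorem uniform_longQueues {n : ℕ} [NeZero n] (m : ℕ) (x : Fin n → ℕ) :
    (PMF.uniformOfFintype (Fin n)).toMeasure {j | m ≤ x j} =
      ENNReal.ofReal (fracAtLeast x m) := by
  rw [PMF.toMeasure_uniformOfFintype_apply _ (MeasurableSet.of_discrete), ofReal_fracAtLeast]
  simp [longQueues, Fintype.card_subtype]

theorem le_of_mem_shortest_iff {n d : ℕ} {x : Fin n → ℕ} {c : Fin d → Fin n} {j : Fin n}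
    (hj : j ∈ shortest x c) (m : ℕ) : m ≤ x j ↔ ∀ k, m ≤ x (c k) := by
  simp only [shortest, Finset.mem_filter, Finset.mem_image, Finset.mem_univ, true_and] at hj
  obtain ⟨⟨k, rfl⟩, h⟩ := hj
  exact ⟨fun hm k => hm.trans (h k), fun hm => hm k⟩

/-- The customer joins a queue of length at least `m` exactly when all sampled queues are. -/
theorem joinedQueue_longQueues (d : ℕ) [NeZero d] {n : ℕ} [NeZero n] (m : ℕ) (x : Fin n → ℕ) :
    (joinedQueue d x).toMeasure {j | m ≤ x j} = ENNReal.ofReal (fracAtLeast x m) ^ d := by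
  have hone : ∀ c : Fin d → Fin n,
      (PMF.uniformOfFinset (shortest x c) (shortest_nonempty x c)).toMeasure {j | m ≤ x j} =
        {c : Fin d → Fin n | ∀ k, m ≤ x (c k)}.indicator 1 c := by
    intro c
    by_cases hc : ∀ k, m ≤ x (c k)
    · rw [Set.indicator_of_mem (by exact hc), Pi.one_apply,
        PMF.toMeasure_apply_eq_one_iff _ MeasurableSet.of_discrete]
      intro j hj
      rw [PMF.mem_support_uniformOfFinset_iff] at hj
      exact (le_of_mem_shortest_iff hj m).2 hc
    · rw [Set.indicator_of_notMem (by exact hc),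
        PMF.toMeasure_apply_eq_zero_iff _ MeasurableSet.of_discrete, Set.disjoint_left]
      intro j hj hm
      rw [PMF.mem_support_uniformOfFinset_iff] at hj
      exact hc ((le_of_mem_shortest_iff hj m).1 hm)
  rw [joinedQueue, toMeasure_bind_eq_lintegral _ _ MeasurableSet.of_discrete]
  simp_rw [hone]
  rw [lintegral_indicator_one MeasurableSet.of_discrete,
    PMF.toMeasure_uniformOfFintype_apply _ MeasurableSet.of_discrete, ofReal_fracAtLeast]
  have hcard : Fintype.card {c : Fin d → Fin n | ∀ k, m ≤ x (c k)} = (longQueues m x).card ^ d := by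
    have : (Fintype.piFinset fun _ : Fin d => longQueues m x).card = (longQueues m x).card ^ d := by
      simp
    rw [← this, Fintype.card_subtype]
    congr 1
    ext c
    simp [longQueues]
  rw [hcard]
  simp [div_eq_mul_inv, mul_pow, ENNReal.inv_pow]

/-! ### Level crossings of the excess and the balance identity. -/

/-- The number of customers with at least `m` customers ahead of them in their queue. -/
def excess {n : ℕ} (m : ℕ) (x : Fin n → ℕ) : ℕ := ∑ j, (x j - m)

theorem excess_eq_add_sum_erase {n : ℕ} (m : ℕ) (x : Fin n → ℕ) (j : Fin n) :
    excess m x = (x j - m) + ∑ i ∈ Finset.univ.erase j, (x i - m) :=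
  (Finset.add_sum_erase _ (fun i => x i - m) (Finset.mem_univ j)).symm

theorem excess_update_add_one {n : ℕ} (m : ℕ) (x : Fin n → ℕ) (j : Fin n) :
    excess m (Function.update x j (x j + 1)) = excess m x + if m ≤ x j then 1 else 0 := by
  rw [excess_eq_add_sum_erase m _ j, excess_eq_add_sum_erase m x j, Function.update_self, Finset.sum_congr rfl fun i hi => by
    rw [Function.update_of_ne (Finset.ne_of_mem_erase hi)]]
  split_ifs <;> omega

theorem excess_update_sub_one {n : ℕ} (m : ℕ) (x : Fin n → ℕ) (j : Fin n) :
    excess m (Function.update x j (x j - 1)) + (if m + 1 ≤ x j then 1 else 0) = excess m x := by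
  rw [excess_eq_add_sum_erase m _ j, excess_eq_add_sum_erase m x j, Function.update_self, Finset.sum_congr rfl fun i hi => by
    rw [Function.update_of_ne (Finset.ne_of_mem_erase hi)]]
  split_ifs <;> omega

theorem fracAtLeast_eq_zero_of_excess {n : ℕ} {m : ℕ} {x : Fin n → ℕ} (h : excess m x = 0) :
    fracAtLeast x (m + 1 : ℕ) = 0 := by
  have : longQueues (m + 1) x = ∅ := by
    simp only [excess, Finset.sum_eq_zero_iff, Finset.mem_univ, true_implies] at h
    refine Finset.filter_eq_empty_iff.2 fun j _ => ?_
    have := h j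
    omega
  rw [fracAtLeast_natCast, this]
  simp

/-- An arrival raises the excess by at most one, so the set can be left only from level `k`, by
joining a queue of length at least `m`. The loss is added on the left to avoid truncated
subtraction. -/
theorem arrival_excess_le (d : ℕ) [NeZero d] {n : ℕ} [NeZero n] (m k : ℕ) (x : Fin n → ℕ) :
    (arrival d x).toMeasure {y | excess m y ≤ k} +
        {y | excess m y = k}.indicator (fun y => ENNReal.ofReal (fracAtLeast y m) ^ d) x =
      {y | excess m y ≤ k}.indicator 1 x := by
  have hm : Measurable fun j => Function.update x j (x j + 1) := .of_discrete
  rw [arrival, PMF.toMeasure_map_apply _ _ _ hm .of_discrete]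
  have hset : (fun j => Function.update x j (x j + 1)) ⁻¹' {y | excess m y ≤ k} =
      {j | excess m x + (if m ≤ x j then 1 else 0) ≤ k} := by
    ext j
    simp [excess_update_add_one]
  rw [hset]
  rcases lt_trichotomy (excess m x) k with h | h | h
  · have : {j | excess m x + (if m ≤ x j then 1 else 0) ≤ k} = Set.univ := by
      refine Set.eq_univ_of_forall fun j => ?_
      simp only [Set.mem_ofPred_eq]
      split_ifs <;> omega
    simp [this, h.ne, h.le]
  · have : {j | excess m x + (if m ≤ x j then 1 else 0) ≤ k} = {j | m ≤ x j}ᶜ := by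
      ext j
      simp only [Set.mem_ofPred_eq, Set.mem_compl_iff]
      split_ifs <;> omega
    rw [this, Set.indicator_of_mem (by exact h), Set.indicator_of_mem (by exact h.le),
      ← joinedQueue_longQueues, add_comm, prob_add_prob_compl .of_discrete, Pi.one_apply]
  · have : {j | excess m x + (if m ≤ x j then 1 else 0) ≤ k} = ∅ := by
      refine Set.eq_empty_of_forall_notMem fun j => ?_
      simp only [Set.mem_ofPred_eq]
      omega
    simp [this, h.ne', h]

theorem service_excess_le {n : ℕ} [NeZero n] (m k : ℕ) (x : Fin n → ℕ) :
    (service x).toMeasure {y | excess m y ≤ k} =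
      {y | excess m y ≤ k}.indicator 1 x +
        {y | excess m y = k + 1}.indicator
          (fun y => ENNReal.ofReal (fracAtLeast y (m + 1 : ℕ))) x := by
  have hm : Measurable fun j => Function.update x j (x j - 1) := .of_discrete
  rw [service, PMF.toMeasure_map_apply _ _ _ hm .of_discrete]
  have hset : (fun j => Function.update x j (x j - 1)) ⁻¹' {y | excess m y ≤ k} =
      {j | excess m x ≤ k + (if m + 1 ≤ x j then 1 else 0)} := by
    ext j
    have := excess_update_sub_one m x j
    simp only [Set.mem_preimage, Set.mem_ofPred_eq]
    omega
  rw [hset]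
  rcases lt_trichotomy (excess m x) (k + 1) with h | h | h
  · have : {j | excess m x ≤ k + (if m + 1 ≤ x j then 1 else 0)} = Set.univ :=
      Set.eq_univ_of_forall fun j => (Nat.lt_succ_iff.1 h).trans (Nat.le_add_right _ _)
    rw [this, Set.indicator_of_mem (by exact Nat.lt_succ_iff.1 h),
      Set.indicator_of_notMem (by exact h.ne), measure_univ, Pi.one_apply, add_zero]
  · have : {j | excess m x ≤ k + (if m + 1 ≤ x j then 1 else 0)} = {j | m + 1 ≤ x j} := by
      ext j
      simp only [Set.mem_ofPred_eq]
      split_ifs <;> omega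
    have h' : x ∉ {y | excess m y ≤ k} := fun hx => by
      simp only [Set.mem_ofPred_eq] at hx
      omega
    rw [this, Set.indicator_of_notMem h', Set.indicator_of_mem (by exact h), zero_add,
      uniform_longQueues]
  · have : {j | excess m x ≤ k + (if m + 1 ≤ x j then 1 else 0)} = ∅ := by
      refine Set.eq_empty_of_forall_notMem fun j => ?_
      simp only [Set.mem_ofPred_eq]
      split_ifs <;> omega
    have h' : ¬ excess m x ≤ k := by omega
    rw [this, Set.indicator_of_notMem (by exact h'), Set.indicator_of_notMem (by exact h.ne'),
      measure_empty, add_zero]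

theorem step_toMeasure_apply (d : ℕ) [NeZero d] {n : ℕ} [NeZero n] (lam : ℝ≥0) (x : Fin n → ℕ)
    (s : Set (Fin n → ℕ)) :
    (step d lam x).toMeasure s =
      ((lam / (1 + lam) : ℝ≥0) : ℝ≥0∞) * (arrival d x).toMeasure s +
        ((1 / (1 + lam) : ℝ≥0) : ℝ≥0∞) * (service x).toMeasure s := by
  rw [step, PMF.toMeasure_bind_apply _ _ _ .of_discrete, tsum_fintype, Fintype.sum_bool]
  simp only [eventType, PMF.ofFintype_apply, cond_true, cond_false]

/-- The rates at which the number of customers with `m` others ahead of them crosses the level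
`k + 1 / 2` upwards and downwards agree in steady state. -/
theorem IsSteadyState.lintegral_level {d : ℕ} [NeZero d] {n : ℕ} [NeZero n] {lam : ℝ≥0}
    {μ : PMF (Fin n → ℕ)} (hμ : IsSteadyState d lam μ) (m k : ℕ) :
    lam * ∫⁻ x, {y | excess m y = k}.indicator
        (fun y => ENNReal.ofReal (fracAtLeast y m) ^ d) x ∂μ.toMeasure =
      ∫⁻ x, {y | excess m y = k + 1}.indicator
        (fun y => ENNReal.ofReal (fracAtLeast y (m + 1 : ℕ))) x ∂μ.toMeasure := by
  set U : (Fin n → ℕ) → ℝ≥0∞ := {y | excess m y = k}.indicator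
    fun y => ENNReal.ofReal (fracAtLeast y m) ^ d
  set D : (Fin n → ℕ) → ℝ≥0∞ := {y | excess m y = k + 1}.indicator
    fun y => ENNReal.ofReal (fracAtLeast y (m + 1 : ℕ))
  set A : Set (Fin n → ℕ) := {y | excess m y ≤ k}
  set p : ℝ≥0 := lam / (1 + lam)
  set q : ℝ≥0 := 1 / (1 + lam)
  have hpq : p + q = 1 := by simp only [p, q]; field_simp; ring
  -- After integration, invariance makes the mass of `A` appear on both sides. It is finite and
  -- cancels, so finiteness of the mean excess is never needed.
  have hpointwise : ∀ x, (step d lam x).toMeasure A + p * U x = A.indicator 1 x + q * D x := by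
    intro x
    rw [step_toMeasure_apply, service_excess_le, add_right_comm, ← mul_add, arrival_excess_le,
      mul_add, ← add_assoc, ← add_mul, ← ENNReal.coe_add, hpq, ENNReal.coe_one, one_mul]
  have hint := lintegral_congr (μ := μ.toMeasure) hpointwise
  rw [lintegral_add_left .of_discrete, lintegral_add_left .of_discrete,
    lintegral_const_mul _ .of_discrete, lintegral_const_mul _ .of_discrete,
    ← toMeasure_bind_eq_lintegral _ _ .of_discrete, hμ.bind_step,
    lintegral_indicator_one .of_discrete, ENNReal.add_right_inj (measure_ne_top _ _)] at hint
  have hp : (lam : ℝ≥0∞) = ((1 + lam : ℝ≥0) : ℝ≥0∞) * p := by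
    rw [← ENNReal.coe_mul]; congr 1; simp only [p]; field_simp
  have hq : ((1 + lam : ℝ≥0) : ℝ≥0∞) * q = 1 := by
    rw [← ENNReal.coe_mul, ← ENNReal.coe_one]; congr 1; simp only [q]; field_simp
  rw [hp, mul_assoc, hint, ← mul_assoc, hq, one_mul]

theorem tsum_indicator_level {α : Type*} (g : α → ℕ) (f : α → ℝ≥0∞) (x : α) :
    ∑' k, {y | g y = k}.indicator f x = f x := by
  have h : ∀ k, k ≠ g x → {y | g y = k}.indicator f x = 0 := fun k hk =>
    Set.indicator_of_notMem (show x ∉ {y | g y = k} from fun h => hk h.symm) f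
  rw [tsum_eq_single (g x) h]
  exact Set.indicator_of_mem (show x ∈ {y | g y = g x} from rfl) f

/-- In steady state, the rate at which customers join queues of length at least `m` agrees with the
rate at which queues of length at least `m + 1` are served. -/
theorem IsSteadyState.lintegral_fracAtLeast_succ {d : ℕ} [NeZero d] {n : ℕ} [NeZero n] {lam : ℝ≥0}
    {μ : PMF (Fin n → ℕ)} (hμ : IsSteadyState d lam μ) (m : ℕ) :
    lam * ∫⁻ x, ENNReal.ofReal (fracAtLeast x m) ^ d ∂μ.toMeasure =
      ∫⁻ x, ENNReal.ofReal (fracAtLeast x (m + 1 : ℕ)) ∂μ.toMeasure := by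
  -- Down-crossings start at levels `k + 1`; level zero may be omitted because no queue there
  -- exceeds length `m`.
  have hlevel : ∀ x : Fin n → ℕ, ∑' k, {y | excess m y = k + 1}.indicator
      (fun y => ENNReal.ofReal (fracAtLeast y (m + 1 : ℕ))) x =
        ENNReal.ofReal (fracAtLeast x (m + 1 : ℕ)) := by
    intro x
    set f : (Fin n → ℕ) → ℝ≥0∞ := fun y => ENNReal.ofReal (fracAtLeast y (m + 1 : ℕ))
    have hzero : {y | excess m y = 0}.indicator f x = 0 :=
      Set.indicator_apply_eq_zero.2 fun h => by
        simp only [f, fracAtLeast_eq_zero_of_excess h, ENNReal.ofReal_zero]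
    have h := (tsum_eq_zero_add' (f := fun k => {y | excess m y = k}.indicator f x)
      ENNReal.summable).symm
    rwa [hzero, zero_add, tsum_indicator_level] at h
  calc lam * ∫⁻ x, ENNReal.ofReal (fracAtLeast x m) ^ d ∂μ.toMeasure
      = ∑' k, lam * ∫⁻ x, {y | excess m y = k}.indicator
          (fun y => ENNReal.ofReal (fracAtLeast y m) ^ d) x ∂μ.toMeasure := by
        rw [ENNReal.tsum_mul_left, ← lintegral_tsum fun _ => Measurable.of_discrete.aemeasurable]
        simp_rw [tsum_indicator_level]
    _ = _ := by
        simp_rw [hμ.lintegral_level]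
        rw [← lintegral_tsum fun _ => Measurable.of_discrete.aemeasurable]
        simp_rw [hlevel]

/-! ### Lower bound for the mean fractions. -/

theorem integrable_fracAtLeast_pow {n : ℕ} (μ : PMF (Fin n → ℕ)) (r : ℝ) (e : ℕ) :
    Integrable (fun x => fracAtLeast x r ^ e) μ.toMeasure :=
  .of_bound Measurable.of_discrete.aestronglyMeasurable 1 <| .of_forall fun x => by
    rw [Real.norm_of_nonneg (pow_nonneg (fracAtLeast_nonneg x r) e)]
    exact pow_le_one₀ (fracAtLeast_nonneg x r) (fracAtLeast_le_one x r)

theorem integrable_fracAtLeast {n : ℕ} (μ : PMF (Fin n → ℕ)) (r : ℝ) :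
    Integrable (fun x => fracAtLeast x r) μ.toMeasure := by
  simpa using integrable_fracAtLeast_pow μ r 1

theorem IsSteadyState.integral_fracAtLeast_succ {d : ℕ} [NeZero d] {n : ℕ} [NeZero n] {lam : ℝ≥0}
    {μ : PMF (Fin n → ℕ)} (hμ : IsSteadyState d lam μ) (m : ℕ) :
    ∫ x, fracAtLeast x (m + 1 : ℕ) ∂μ.toMeasure =
      lam * ∫ x, fracAtLeast x m ^ d ∂μ.toMeasure := by
  rw [integral_eq_lintegral_of_nonneg_ae (.of_forall fun x => fracAtLeast_nonneg x _)
      Measurable.of_discrete.aestronglyMeasurable, ← hμ.lintegral_fracAtLeast_succ,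
    integral_eq_lintegral_of_nonneg_ae (.of_forall fun x => pow_nonneg (fracAtLeast_nonneg x _) d)
      Measurable.of_discrete.aestronglyMeasurable]
  simp_rw [ENNReal.ofReal_pow (fracAtLeast_nonneg _ _)]
  simp

theorem one_sub_mul_le_integral_fracAtLeast_pow {n : ℕ} (μ : PMF (Fin n → ℕ)) (r : ℝ) (d : ℕ) :
    1 - d * (1 - ∫ x, fracAtLeast x r ∂μ.toMeasure) ≤ ∫ x, fracAtLeast x r ^ d ∂μ.toMeasure := by
  have h : ∫ x, (1 + d * (fracAtLeast x r - 1)) ∂μ.toMeasure ≤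
      ∫ x, fracAtLeast x r ^ d ∂μ.toMeasure := by
    refine integral_mono ?_ (integrable_fracAtLeast_pow μ r d) fun x => ?_
    · exact (integrable_const _).add
        (((integrable_fracAtLeast μ r).sub (integrable_const _)).const_mul _)
    · have := one_add_mul_le_pow (a := fracAtLeast x r - 1)
        (by linarith [fracAtLeast_nonneg x r]) d
      simpa using this
  rw [integral_add (integrable_const _)
    (by exact ((integrable_fracAtLeast μ r).sub (integrable_const _)).const_mul _),
    integral_const_mul,
    integral_sub (integrable_fracAtLeast μ r) (integrable_const _)] at h
  simp only [integral_const, probReal_univ, one_smul] at h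
  linarith

theorem IsSteadyState.le_integral_fracAtLeast {d : ℕ} [NeZero d] (hd : 2 ≤ d) {n : ℕ} [NeZero n]
    {lam : ℝ≥0} (hlam : lam ≤ 1) {μ : PMF (Fin n → ℕ)} (hμ : IsSteadyState d lam μ) (i : ℕ) :
    1 - (1 - (lam : ℝ)) * (((d : ℝ) ^ i - 1) / ((d : ℝ) - 1)) ≤
      ∫ x, fracAtLeast x i ∂μ.toMeasure := by
  have hd1 : (1 : ℝ) < d := by exact_mod_cast hd
  have hl1 : (lam : ℝ) ≤ 1 := by exact_mod_cast hlam
  induction i with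
  | zero =>
    have : ∀ x : Fin n → ℕ, fracAtLeast x (0 : ℕ) = 1 := fun x => by
      rw [fracAtLeast_natCast]
      have : (n : ℝ) ≠ 0 := by exact_mod_cast NeZero.ne n
      simp [longQueues, this]
    simp_rw [this]
    simp
  | succ i ih =>
    rw [hμ.integral_fracAtLeast_succ]
    have h1 := mul_le_mul_of_nonneg_left
      (one_sub_mul_le_integral_fracAtLeast_pow μ i d) lam.coe_nonneg
    have hG : ((d : ℝ) ^ (i + 1) - 1) / ((d : ℝ) - 1) =
        1 + d * (((d : ℝ) ^ i - 1) / ((d : ℝ) - 1)) := by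
      have : (d : ℝ) - 1 ≠ 0 := by linarith
      field_simp
      ring
    have hG0 : 0 ≤ ((d : ℝ) ^ i - 1) / ((d : ℝ) - 1) :=
      div_nonneg (sub_nonneg.2 (one_le_pow₀ hd1.le)) (by linarith)
    rw [hG]
    refine le_trans ?_ h1
    set G := ((d : ℝ) ^ i - 1) / ((d : ℝ) - 1)
    set E := ∫ x, fracAtLeast x i ∂μ.toMeasure
    have h2 : (lam : ℝ) * (d * (1 - E)) ≤ lam * (d * ((1 - lam) * G)) := by
      gcongr; linarith
    -- Dropping the factor `lam` turns the recursion into that of the geometric sum in `hG`.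
    have h3 : (lam : ℝ) * (d * ((1 - lam) * G)) ≤ 1 * (d * ((1 - lam) * G)) :=
      mul_le_mul_of_nonneg_right hl1 (by have := sub_nonneg.2 hl1; positivity)
    linarith

/-! ### Moments and lower tail of the delay. -/

instance isProbabilityMeasure_expMeasure_one : IsProbabilityMeasure (expMeasure 1) :=
  isProbabilityMeasure_expMeasure one_pos

/-- Rewrites the moment integrand as the integrand of `Γ(k + 1)`. The point zero is excluded since
the two sides differ there when `k = 0`. -/
theorem toReal_gammaPDF_one_smul (k : ℕ) :
    (fun x : ℝ => (gammaPDF 1 1 x).toReal • x ^ k) =ᵐ[volume]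
      (Set.Ioi (0 : ℝ)).indicator fun x => Real.exp (-x) * x ^ ((k + 1 : ℝ) - 1) := by
  filter_upwards [compl_mem_ae_iff.2 (measure_singleton (0 : ℝ))] with x hx
  rcases lt_or_gt_of_ne (show x ≠ 0 from hx) with h | h
  · rw [Set.indicator_of_notMem (by simpa using h.le), gammaPDF_of_neg h]
    simp
  · rw [Set.indicator_of_mem (by exact h), gammaPDF_of_nonneg h.le]
    simp [Real.exp_nonneg]

theorem integrable_pow_expMeasure (k : ℕ) : Integrable (fun x => x ^ k) (expMeasure 1) := by
  have hm : Measurable (gammaPDF 1 1) := (measurable_gammaPDFReal 1 1).ennreal_ofReal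
  rw [expMeasure, gammaMeasure, integrable_withDensity_iff_integrable_smul' hm
    (.of_forall fun x => ENNReal.ofReal_lt_top), integrable_congr (toReal_gammaPDF_one_smul k),
    integrable_indicator_iff measurableSet_Ioi]
  exact Real.GammaIntegral_convergent (by positivity)

theorem integral_pow_expMeasure (k : ℕ) : ∫ x, x ^ k ∂(expMeasure 1) = k.factorial := by
  have hm : Measurable (gammaPDF 1 1) := (measurable_gammaPDFReal 1 1).ennreal_ofReal
  rw [expMeasure, gammaMeasure, integral_withDensity_eq_integral_toReal_smul hm
    (.of_forall fun x => ENNReal.ofReal_lt_top), integral_congr_ae (toReal_gammaPDF_one_smul k),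
    integral_indicator measurableSet_Ioi, ← Real.Gamma_eq_integral (by positivity),
    Real.Gamma_nat_eq_factorial]

theorem memLp_id_expMeasure : MemLp id 2 (expMeasure 1) :=
  (memLp_two_iff_integrable_sq measurable_id.aestronglyMeasurable).2 (integrable_pow_expMeasure 2)

theorem variance_expMeasure : Var[id; expMeasure 1] = 1 := by
  rw [variance_eq_sub memLp_id_expMeasure]
  have h1 := integral_pow_expMeasure 1
  have h2 := integral_pow_expMeasure 2
  simp only [pow_one] at h1
  simp only [Pi.pow_apply, id, h1, h2]
  norm_num

theorem ae_nonneg_expMeasure : ∀ᵐ x ∂(expMeasure 1), 0 ≤ x := by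
  have hm : Measurable (gammaPDF 1 1) := (measurable_gammaPDFReal 1 1).ennreal_ofReal
  rw [expMeasure, gammaMeasure, ae_withDensity_iff hm]
  refine .of_forall fun x hx => ?_
  by_contra h
  exact hx (gammaPDF_of_neg (not_le.1 h))

instance isProbabilityMeasure_delayGiven (m : ℕ) : IsProbabilityMeasure (delayGiven m) :=
  Measure.isProbabilityMeasure_map (by fun_prop)

theorem memLp_delayGiven (m : ℕ) : MemLp id 2 (delayGiven m) := by
  rw [delayGiven, memLp_map_measure_iff measurable_id.aestronglyMeasurable (by fun_prop)]
  exact memLp_finsetSum Finset.univ fun i _ => memLp_id_expMeasure.comp_measurePreserving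
    (measurePreserving_eval (fun _ : Fin m => expMeasure 1) i)

theorem integral_delayGiven (m : ℕ) : ∫ w, w ∂(delayGiven m) = m := by
  have h1 := integral_pow_expMeasure 1
  simp only [pow_one, Nat.factorial_one, Nat.cast_one] at h1
  have hi := integrable_pow_expMeasure 1
  simp only [pow_one] at hi
  rw [delayGiven, integral_map (by fun_prop) (by fun_prop),
    integral_finsetSum _ fun i _ => integrable_comp_eval (μ := fun _ => expMeasure 1) hi]
  have h : ∀ i : Fin m, ∫ v : Fin m → ℝ, v i ∂(Measure.pi fun _ => expMeasure 1) = 1 := fun i => by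
    rw [integral_comp_eval (μ := fun _ => expMeasure 1) (f := fun x => x)
      measurable_id.aestronglyMeasurable, h1]
  simp [h]

theorem variance_delayGiven (m : ℕ) : Var[id; delayGiven m] = m := by
  rw [delayGiven, variance_id_map (by fun_prop)]
  have h := variance_sum_pi (μ := fun _ : Fin m => expMeasure 1) (X := fun _ => id)
    fun _ => memLp_id_expMeasure
  simp only [variance_expMeasure] at h
  simpa [Finset.sum_fn] using h

theorem ae_nonneg_delayGiven (m : ℕ) : ∀ᵐ w ∂(delayGiven m), 0 ≤ w := by
  rw [delayGiven, ae_map_iff (by fun_prop) measurableSet_Ici]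
  have h : ∀ i : Fin m, ∀ᵐ v : Fin m → ℝ ∂(Measure.pi fun _ => expMeasure 1), 0 ≤ v i := fun i =>
    (measurePreserving_eval (fun _ : Fin m => expMeasure 1) i).quasiMeasurePreserving.ae
      ae_nonneg_expMeasure
  filter_upwards [ae_all_iff.2 h] with v hv
  exact Finset.sum_nonneg fun i _ => hv i

/-- Chebyshev's inequality for the lower tail of the delay. -/
theorem delayGiven_lt_le {m : ℕ} {r : ℝ} (hr : r < m) :
    delayGiven m {w | w < r} ≤ ENNReal.ofReal (m / (m - r) ^ 2) := by
  have h := meas_ge_le_variance_div_sq (memLp_delayGiven m) (sub_pos.2 hr)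
  rw [variance_delayGiven] at h
  refine (measure_mono fun w hw => ?_).trans h
  simp only [Set.mem_ofPred_eq, id, integral_delayGiven] at hw ⊢
  rw [abs_sub_comm]
  exact le_abs.2 (Or.inl (by linarith))

/-- A customer with at least `r + h` customers ahead rarely waits for less than `r`. -/
theorem delayGiven_lt_le_of_add_le {m : ℕ} {r h : ℝ} (hh : 0 < h) (hm : r + h ≤ m) :
    delayGiven m {w | w < r} ≤ ENNReal.ofReal (1 / h + r / h ^ 2) := by
  rcases le_or_gt r 0 with hr | hr
  · refine le_of_eq_of_le ?_ zero_le
    refine measure_mono_null (fun w hw => ?_) (ae_iff.1 (ae_nonneg_delayGiven m))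
    simp only [Set.mem_ofPred_eq] at hw ⊢
    linarith
  · refine (delayGiven_lt_le (by linarith)).trans (ENNReal.ofReal_le_ofReal ?_)
    have hpos : 0 < (m : ℝ) - r := by linarith
    -- With `r > 0`, both summands decrease in `m - r ≥ h`, which makes the bound uniform in `m`.
    have heq : (m : ℝ) / (m - r) ^ 2 = 1 / (m - r) + r / (m - r) ^ 2 := by
      field_simp
      ring
    rw [heq]
    gcongr <;> linarith

/-! ### Estimates at real heights. -/

theorem fracAtLeast_natCeil {n : ℕ} (x : Fin n → ℕ) (r : ℝ) :
    fracAtLeast x r = fracAtLeast x (⌈r⌉₊ : ℕ) := by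
  unfold fracAtLeast
  simp only [Nat.cast_le, Nat.ceil_le]

theorem joinedLength_ge (d : ℕ) [NeZero d] {n : ℕ} [NeZero n] (μ : PMF (Fin n → ℕ)) (r : ℝ) :
    (joinedLength d μ).toMeasure {m | r ≤ (m : ℝ)} =
      ENNReal.ofReal (∫ x, fracAtLeast x r ^ d ∂μ.toMeasure) := by
  rw [joinedLength, toMeasure_bind_eq_lintegral _ _ .of_discrete,
    ofReal_integral_eq_lintegral_ofReal (integrable_fracAtLeast_pow μ r d)
      (.of_forall fun x => pow_nonneg (fracAtLeast_nonneg x _) d)]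
  refine lintegral_congr fun x => ?_
  rw [ENNReal.ofReal_pow (fracAtLeast_nonneg _ _), fracAtLeast_natCeil, ← joinedQueue_longQueues,
    PMF.toMeasure_map_apply _ _ _ .of_discrete .of_discrete]
  congr 1
  ext j
  simp [Nat.ceil_le]

theorem IsSteadyState.one_sub_integral_fracAtLeast_le {d : ℕ} [NeZero d] (hd : 2 ≤ d) {n : ℕ}
    [NeZero n] {lam : ℝ≥0} (hlam : lam ≤ 1) {μ : PMF (Fin n → ℕ)} (hμ : IsSteadyState d lam μ)
    {η : ℝ} (hη : 0 < η) (ω : ℝ) :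
    1 - ∫ x, fracAtLeast x (Real.logb d η - ω) ∂μ.toMeasure ≤
      η * (1 - lam) * (d / (d - 1)) * (d : ℝ) ^ (-ω) := by
  have hd1 : (1 : ℝ) < d := by exact_mod_cast hd
  have hd0 : (0 : ℝ) < d := by linarith
  have hd2 : (0 : ℝ) < (d : ℝ) - 1 := by linarith
  have hl : (0 : ℝ) ≤ 1 - lam := sub_nonneg.2 (by exact_mod_cast hlam)
  set r := Real.logb d η - ω with hr
  have ha := hμ.le_integral_fracAtLeast hd hlam ⌈r⌉₊
  simp_rw [fracAtLeast_natCeil _ r]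
  rcases le_or_gt r 0 with h0 | h0
  · have hpos : 0 ≤ η * (1 - lam) * (d / (d - 1)) * (d : ℝ) ^ (-ω) := by positivity
    rw [Nat.ceil_eq_zero.2 h0] at ha ⊢
    simp only [pow_zero, sub_self, zero_div, mul_zero, sub_zero] at ha
    exact (sub_nonpos.2 ha).trans hpos
  -- The extra factor `d` is the cost of rounding `r` up to an integer.
  · have hpow : (d : ℝ) ^ ⌈r⌉₊ ≤ d * (η * (d : ℝ) ^ (-ω)) := by
      calc (d : ℝ) ^ ⌈r⌉₊ = (d : ℝ) ^ ((⌈r⌉₊ : ℕ) : ℝ) := (Real.rpow_natCast _ _).symm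
        _ ≤ (d : ℝ) ^ (1 + (Real.logb d η + -ω)) :=
          Real.rpow_le_rpow_of_exponent_le hd1.le (by linarith [Nat.ceil_lt_add_one h0.le])
        _ = d * (η * (d : ℝ) ^ (-ω)) := by
          rw [Real.rpow_add hd0, Real.rpow_add hd0, Real.rpow_one,
            Real.rpow_logb hd0 hd1.ne' hη]
    calc 1 - ∫ x, fracAtLeast x (⌈r⌉₊ : ℕ) ∂μ.toMeasure
        ≤ (1 - lam) * (((d : ℝ) ^ ⌈r⌉₊ - 1) / (d - 1)) := by linarith
      _ ≤ (1 - lam) * ((d * (η * (d : ℝ) ^ (-ω))) / (d - 1)) := by gcongr; linarith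
      _ = _ := by ring

theorem tendsto_one_of_one_sub_le_toReal {ι : Type*} {l : Filter ι} {p : ι → ℝ≥0∞} {T : ι → ℝ}
    (hp : ∀ n, p n ≤ 1) (hT : Tendsto T l (𝓝 0)) (h : ∀ n, 1 - T n ≤ (p n).toReal) :
    Tendsto p l (𝓝 1) := by
  have h1 : Tendsto (fun n => ENNReal.ofReal (1 - T n)) l (𝓝 1) := by
    simpa using ENNReal.tendsto_ofReal (hT.const_sub 1)
  refine tendsto_of_tendsto_of_tendsto_of_le_of_le h1 tendsto_const_nhds (fun n => ?_) hp
  exact (ENNReal.ofReal_le_iff_le_toReal (ne_top_of_le_ne_top ENNReal.one_ne_top (hp n))).2 (h n)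

theorem one_sub_div_le_measure_fracAtLeast {n : ℕ} (μ : PMF (Fin n → ℕ)) (r : ℝ) {ε : ℝ}
    (hε : 0 < ε) :
    1 - (1 - ∫ x, fracAtLeast x r ∂μ.toMeasure) / ε ≤
      (μ.toMeasure {x | 1 - ε < fracAtLeast x r}).toReal := by
  have hint : Integrable (fun x => 1 - fracAtLeast x r) μ.toMeasure :=
    (integrable_const _).sub (integrable_fracAtLeast μ r)
  have h := mul_meas_ge_le_integral_of_nonneg (μ := μ.toMeasure)
    (.of_forall fun x => sub_nonneg.2 (fracAtLeast_le_one x r)) hint ε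
  rw [integral_sub (integrable_const _) (integrable_fracAtLeast μ r)] at h
  simp only [integral_const, probReal_univ, one_smul] at h
  have hcompl : {x : Fin n → ℕ | 1 - ε < fracAtLeast x r} = {x | ε ≤ 1 - fracAtLeast x r}ᶜ := by
    ext x
    simp only [Set.mem_ofPred_eq, Set.mem_compl_iff, not_le]
    constructor <;> intro <;> linarith
  rw [← measureReal_def, hcompl, probReal_compl_eq_one_sub .of_discrete]
  rw [← le_div_iff₀' hε] at h
  linarith

/-- Keep only joined queues of length at least `r + h` and apply the uniform tail bound to each. -/
theorem mul_joinedLength_le_delayLaw (d : ℕ) [NeZero d] {n : ℕ} [NeZero n] (μ : PMF (Fin n → ℕ))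
    {r h : ℝ} (hh : 0 < h) :
    (1 - ENNReal.ofReal (1 / h + r / h ^ 2)) *
        (joinedLength d μ).toMeasure {m | r + h ≤ (m : ℝ)} ≤ delayLaw d μ {w | r ≤ w} := by
  have hm : Measurable delayGiven := .of_discrete
  rw [delayLaw, Measure.bind_apply (s := {w | r ≤ w}) measurableSet_Ici hm.aemeasurable,
    ← lintegral_indicator_const .of_discrete]
  refine lintegral_mono fun m =>
    Set.indicator_apply_le (g := fun m => delayGiven m {w | r ≤ w}) fun hm => ?_
  have hcompl : {w : ℝ | r ≤ w} = {w | w < r}ᶜ := by ext; simp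
  rw [hcompl, prob_compl_eq_one_sub (s := {w | w < r}) measurableSet_Iio]
  exact tsub_le_tsub_left (delayGiven_lt_le_of_add_le hh (by exact hm)) _

end

end Supermarket

/-! ### Limits and the main theorem. -/

theorem theorem5 (d : ℕ) [NeZero d] (hd : 2 ≤ d)
    (lam : ℕ+ → ℝ≥0) (hlam : ∀ n, lam n < 1)
    (η : ℕ+ → ℝ) (hη_one : ∀ n, 1 ≤ η n) (hη : Tendsto η atTop atTop)
    (β : ℝ) (hβ : 0 < β) (hrate : Tendsto (fun n => η n * (1 - (lam n : ℝ))) atTop (𝓝 β))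
    (μ : ∀ n : ℕ+, PMF (Fin n → ℕ))
    (hμ : ∀ n, Supermarket.IsSteadyState d (lam n) (μ n)) :
    -- the expected fraction of queues of length at least `i`
    (∀ (n : ℕ+) (i : ℕ),
      1 - (1 - (lam n : ℝ)) * (((d : ℝ) ^ i - 1) / ((d : ℝ) - 1)) ≤
        ∫ x, Supermarket.fracAtLeast x i ∂(μ n).toMeasure) ∧
    ∀ ω : ℕ+ → ℝ, Tendsto ω atTop atTop →
      -- the fraction of queues of length at least `log_d η_n - ω_n` tends to one in probability
      (∀ ε : ℝ, 0 < ε →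
        Tendsto (fun n => (μ n).toMeasure
          {x | 1 - ε < Supermarket.fracAtLeast x (Real.logb d (η n) - ω n)}) atTop (𝓝 1)) ∧
      -- an arriving customer joins a queue with at least that many customers
      Tendsto (fun n => (Supermarket.joinedLength d (μ n)).toMeasure
        {m | Real.logb d (η n) - ω n ≤ (m : ℝ)}) atTop (𝓝 1) ∧
      -- the mean delay of an arriving customer, given the joined queue, is at least that long
      Tendsto (fun n => (Supermarket.joinedLength d (μ n)).toMeasure
        {m | Real.logb d (η n) - ω n ≤ ∫ w, w ∂(Supermarket.delayGiven m)}) atTop (𝓝 1) ∧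
      -- so is the delay itself, when `ω_n` dominates the fluctuations of the service times
      (Tendsto (fun n => ω n / √(Real.logb d (η n))) atTop atTop →
        Tendsto (fun n => Supermarket.delayLaw d (μ n)
          {w | Real.logb d (η n) - ω n ≤ w}) atTop (𝓝 1)) := by
  have hd1 : (1 : ℝ) < d := by exact_mod_cast hd
  have hmean : ∀ ω : ℕ+ → ℝ, Tendsto ω atTop atTop → Tendsto (fun n =>
      1 - ∫ x, Supermarket.fracAtLeast x (Real.logb d (η n) - ω n) ∂(μ n).toMeasure)
      atTop (𝓝 0) := by
    intro ω hω
    have hpow : Tendsto (fun n => (d : ℝ) ^ (-ω n)) atTop (𝓝 0) :=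
      (tendsto_rpow_atBot_of_base_gt_one d hd1).comp (tendsto_neg_atTop_atBot.comp hω)
    have hT := (hrate.mul_const ((d : ℝ) / (d - 1))).mul hpow
    rw [mul_zero] at hT
    refine squeeze_zero (fun n => ?_) (fun n => (hμ n).one_sub_integral_fracAtLeast_le hd
      (hlam n).le (zero_lt_one.trans_le (hη_one n)) (ω n)) hT
    refine sub_nonneg.2 ?_
    have h := integral_mono (Supermarket.integrable_fracAtLeast (μ n) (Real.logb d (η n) - ω n))
      (integrable_const (1 : ℝ)) fun x => Supermarket.fracAtLeast_le_one x _
    simpa using h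
  have hjoin : ∀ ω : ℕ+ → ℝ, Tendsto ω atTop atTop →
      Tendsto (fun n => (Supermarket.joinedLength d (μ n)).toMeasure
        {m | Real.logb d (η n) - ω n ≤ (m : ℝ)}) atTop (𝓝 1) := by
    intro ω hω
    have hT := (hmean ω hω).const_mul (d : ℝ)
    rw [mul_zero] at hT
    refine Supermarket.tendsto_one_of_one_sub_le_toReal (fun n => prob_le_one) hT fun n => ?_
    rw [Supermarket.joinedLength_ge, ENNReal.toReal_ofReal
      (integral_nonneg fun x => pow_nonneg (Supermarket.fracAtLeast_nonneg x _) d)]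
    exact Supermarket.one_sub_mul_le_integral_fracAtLeast_pow _ _ _
  refine ⟨fun n i => (hμ n).le_integral_fracAtLeast hd (hlam n).le i, fun ω hω =>
    ⟨fun ε hε => ?_, hjoin ω hω, ?_, fun hsqrt => ?_⟩⟩
  · have hT := (hmean ω hω).div_const ε
    rw [zero_div] at hT
    exact Supermarket.tendsto_one_of_one_sub_le_toReal (fun n => prob_le_one) hT fun n =>
      Supermarket.one_sub_div_le_measure_fracAtLeast _ _ hε
  · simp_rw [Supermarket.integral_delayGiven]
    exact hjoin ω hω
  -- Take `h = ω / 2` and `r = log_d η - ω`, so that `r + h = log_d η - ω / 2`. As `r ≤ log_d η`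
  -- once `ω > 0`, the Chebyshev error is at most `1 / h + log_d η / h ^ 2`, which vanishes by
  -- `hsqrt`.
  · have hhalf : Tendsto (fun n => ω n / 2) atTop atTop := hω.atTop_div_const two_pos
    have hinv : Tendsto (fun n => 1 / (ω n / 2)) atTop (𝓝 0) := by
      simp only [one_div]
      exact hhalf.inv_tendsto_atTop
    have hsq : Tendsto (fun n => Real.logb d (η n) / (ω n / 2) ^ 2) atTop (𝓝 0) := by
      have h := (tendsto_inv_atTop_zero.comp
        ((tendsto_pow_atTop two_ne_zero).comp hsqrt)).const_mul 4
      rw [mul_zero] at h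
      refine h.congr fun n => ?_
      simp only [Function.comp_apply]
      rw [div_pow, Real.sq_sqrt (Real.logb_nonneg hd1 (hη_one n)), inv_div, div_pow]
      ring
    have hlower := ENNReal.Tendsto.mul
      (ENNReal.Tendsto.sub (tendsto_const_nhds (x := (1 : ℝ≥0∞)))
        (ENNReal.tendsto_ofReal (hinv.add hsq)) (Or.inl ENNReal.one_ne_top))
      (by simp) (hjoin _ hhalf) (by simp)
    simp only [add_zero, ENNReal.ofReal_zero, tsub_zero, mul_one] at hlower
    refine tendsto_of_tendsto_of_tendsto_of_le_of_le' hlower tendsto_const_nhds ?_ ?_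
    · filter_upwards [hω.eventually_gt_atTop 0] with n hn
      refine le_trans ?_ (Supermarket.mul_joinedLength_le_delayLaw d (μ n) (half_pos hn))
      rw [sub_add, sub_half]
      gcongr
      linarith
    · refine .of_forall fun n => ?_
      have : IsProbabilityMeasure (Supermarket.delayLaw d (μ n)) :=
        isProbabilityMeasure_bind Measurable.of_discrete.aemeasurable
          (.of_forall Supermarket.isProbabilityMeasure_delayGiven)
      exact prob_le_one
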